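/- Let $H$ be a nonzero separable real or complex Hilbert space, let $T$ be a bounded invertible operator on $H$ (with bounded inverse), and let $\mathcal E_T=\{Tx:\|x\|=1\}$ be its ellipsoidal surface. A finite or countably infinite family $(x_i)_{i\in I}$ in $H$ (repetitions allowed) is a tight frame with frame bound $K>0$ if its linear span is dense and $\sum_{i\in I}|\langle v,x_i\rangle|^2=K\|v\|^2$ for all $v\in H$; its length is the number of indices. Write $|T^*|=(TT^*)^{1/2}$, so that $|T^*|^{-2}=(TT^*)^{-1}$. If $S$ is any positive invertible operator with $\mathcal E_S=\mathcal E_T$, then $(TT^*)^{-1}=S^{-2}$; in particular $(TT^*)^{-1}=T^{-2}$ when $T$ is positive. Moreover: 1. $\mathcal E_T$ contains a tight frame. 2. If $n=\dim H<\infty$, then for every integer $k\ge n$ the surface $\mathcal E_T$ contains a tight frame of length $k$, and every tight frame of length $k$ contained in $\mathcal E_T$ has frame bound $K=k\,[\operatorname{trace}(|T^*|^{-2})]^{-1}$. (This is $k\,[\operatorname{trace}(T^{-2})]^{-1}$ if $T$ is positive.) 3. If $\dim H=\infty$, then for every constant $K>\big(\||T^*|^{-2}\|_{\mathrm{ess}}\big)^{-1}$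 the surface $\mathcal E_T$ contains a tight frame with frame bound $K$, where $\|B\|_{\mathrm{ess}}=\inf\{\|B-C\|: C \text{ a compact operator on } H\}$. (The condition is $K>\|T^{-2}\|_{\mathrm{ess}}^{-1}$ if $T$ is positive.) -/

import Mathlib

section EllipsoidalFrames

variable {𝕜 : Type*} [RCLike 𝕜] {H : Type*} [NormedAddCommGroup H] [InnerProductSpace 𝕜 H]

/-- The family `x` (repetitions allowed) is a frame for `H` with frame bounds `A` and `B`:
it is complete, i.e. its linear span is dense, and
`A ‖v‖² ≤ ∑ |⟨v, x i⟩|² ≤ B ‖v‖²` for all `v`, with `0 < A ≤ B`. -/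
structure IsFrameWith (𝕜 : Type*) [RCLike 𝕜] {H : Type*} [NormedAddCommGroup H]
    [InnerProductSpace 𝕜 H] {ι : Type*} (A B : ℝ) (x : ι → H) : Prop where
  pos : 0 < A
  le : A ≤ B
  complete : Dense (Submodule.span 𝕜 (Set.range x) : Set H)
  summable : ∀ v : H, Summable fun i => ‖inner 𝕜 (x i) v‖ ^ 2
  lower : ∀ v : H, A * ‖v‖ ^ 2 ≤ ∑' i, ‖inner 𝕜 (x i) v‖ ^ 2
  upper : ∀ v : H, ∑' i, ‖inner 𝕜 (x i) v‖ ^ 2 ≤ B * ‖v‖ ^ 2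

/-- A tight frame with frame bound `K`. -/
def IsTightFrame (𝕜 : Type*) [RCLike 𝕜] {H : Type*} [NormedAddCommGroup H]
    [InnerProductSpace 𝕜 H] {ι : Type*} (K : ℝ) (x : ι → H) : Prop :=
  IsFrameWith 𝕜 K K x

/-- The ellipsoidal surface of a bounded invertible operator: the image of the unit sphere. -/
def ellipsoid (T : (H →L[𝕜] H)ˣ) : Set H :=
  (T : H →L[𝕜] H) '' Metric.sphere 0 1

/-- `x` is an ellipsoidal tight frame for the surface of `T`, with frame bound `K`. -/
def IsETF {ι : Type*} (T : (H →L[𝕜] H)ˣ) (K : ℝ) (x : ι → H) : Prop :=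
  (∀ i, x i ∈ ellipsoid T) ∧ IsTightFrame 𝕜 K x

/-- `K` is an attainable frame bound: some finite or countably infinite ellipsoidal tight frame
has frame bound `K`. -/
def IsAttainable (T : (H →L[𝕜] H)ˣ) (K : ℝ) : Prop :=
  ∃ (ι : Type) (_ : Countable ι) (x : ι → H), IsETF T K x

/-- The essential norm: the distance to the compact operators. -/
noncomputable def essNorm (B : H →L[𝕜] H) : ℝ :=
  sInf {r : ℝ | ∃ C : H →L[𝕜] H, IsCompactOperator C ∧ r = ‖B - C‖}

/-- The operator `(T T*)⁻¹ = |T*|⁻²`. For a positive `T` it is `T⁻²`; in general `|T*|` is the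
positive operator that has the same ellipsoidal surface as `T`. -/
noncomputable def invSq [CompleteSpace H] (T : (H →L[𝕜] H)ˣ) : H →L[𝕜] H :=
  ((T * star T)⁻¹ : (H →L[𝕜] H)ˣ)

end EllipsoidalFrames

/-! With `R = T⁻¹`, a vector lies on the surface iff `‖R x‖ = 1`, so the task is to find a family
with frame operator `K` and all these norms equal to 1. Rotating two entries changes neither the
frame operator nor `∑ ‖R (y i)‖²`, and by the intermediate value theorem it can move one entry to
the value 1. Hence only the total matters (`exists_fin_norm_eq_one`): it must be an integer not
below the number of entries.

In finite dimension a scaled orthonormal basis has total `k` for the right `K`, and a double sum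
shows that no other `K` occurs. In infinite dimension, `K` above the inverse essential norm yields
an orthonormal sequence on which `K ‖R f‖²` stays above some `δ > 1`. Completed to a Parseval frame
and cut into finite blocks, it supplies enough surplus to make every block total a large enough
integer, by splitting vectors between neighbouring blocks (`exists_parseval_norm_eq_one`). -/

section EllipsoidalFramesAux

variable {𝕜 : Type*} [RCLike 𝕜] {H : Type*} [NormedAddCommGroup H] [InnerProductSpace 𝕜 H]

/-! ### Redistributing norms in finite families by rotations -/

/-- Rotating a pair of vectors does not change the sum of the squares of their norms. -/
theorem norm_sq_rotation {a b : H} {c s : ℝ} (h : c ^ 2 + s ^ 2 = 1) :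
    ‖(c : 𝕜) • a + (s : 𝕜) • b‖ ^ 2 + ‖(-s : 𝕜) • a + (c : 𝕜) • b‖ ^ 2 = ‖a‖ ^ 2 + ‖b‖ ^ 2 := by
  rw [norm_add_sq (𝕜 := 𝕜), norm_add_sq (𝕜 := 𝕜)]
  simp only [norm_smul, inner_smul_left, inner_smul_right, norm_neg, RCLike.norm_ofReal, map_neg,
    RCLike.conj_ofReal, mul_pow, sq_abs, neg_mul, RCLike.re_ofReal_mul]
  linear_combination (‖a‖ ^ 2 + ‖b‖ ^ 2) * h

/-- Rotating a pair of vectors preserves the frame operator of the pair. -/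
theorem norm_inner_sq_rotation {a b : H} {c s : ℝ} (h : c ^ 2 + s ^ 2 = 1) (v : H) :
    ‖inner 𝕜 ((c : 𝕜) • a + (s : 𝕜) • b) v‖ ^ 2 + ‖inner 𝕜 ((-s : 𝕜) • a + (c : 𝕜) • b) v‖ ^ 2 =
      ‖inner 𝕜 a v‖ ^ 2 + ‖inner 𝕜 b v‖ ^ 2 := by
  simpa [inner_add_left, inner_smul_left] using
    norm_sq_rotation (𝕜 := 𝕜) (a := inner 𝕜 a v) (b := inner 𝕜 b v) h

/-- If the value `1` lies between `‖R a‖²` and `‖R b‖²`, some rotation of the pair `(a, b)` takes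
it in the first vector. -/
theorem exists_rotation_norm_eq_one (R : H →L[𝕜] H) {a b : H} (ha : ‖R a‖ ^ 2 ≤ 1)
    (hb : 1 ≤ ‖R b‖ ^ 2) :
    ∃ c s : ℝ, c ^ 2 + s ^ 2 = 1 ∧ ‖R ((c : 𝕜) • a + (s : 𝕜) • b)‖ ^ 2 = 1 := by
  let φ : ℝ → ℝ := fun θ => ‖R (((Real.cos θ : ℝ) : 𝕜) • a + ((Real.sin θ : ℝ) : 𝕜) • b)‖ ^ 2
  have hφ : Continuous φ := by fun_prop
  obtain ⟨θ, -, hθ⟩ := intermediate_value_Icc (f := φ) Real.pi_div_two_pos.le hφ.continuousOn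
    (show (1 : ℝ) ∈ Set.Icc (φ 0) (φ (Real.pi / 2)) from ⟨by simpa [φ] using ha, by simpa [φ] using hb⟩)
  exact ⟨Real.cos θ, Real.sin θ, Real.cos_sq_add_sin_sq θ, hθ⟩

/-- Replacing two entries of a family by a pair with the same sum preserves the total sum. -/
theorem sum_update_update {κ E : Type*} [Fintype κ] [DecidableEq κ] {y : κ → E} {i j : κ}
    (hij : i ≠ j) {a b : E} (F : E → ℝ) (h : F a + F b = F (y i) + F (y j)) :
    ∑ l, F (Function.update (Function.update y i a) j b l) = ∑ l, F (y l) := by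
  have key : ∀ f : κ → ℝ, ∑ l, f l = f i + f j + ∑ l ∈ {i, j}ᶜ, f l := fun f => by
    rw [← Finset.sum_pair hij, Finset.sum_add_sum_compl]
  rw [key, key fun l => F (y l)]
  have : ∀ l ∈ ({i, j}ᶜ : Finset κ),
      F (Function.update (Function.update y i a) j b l) = F (y l) := by
    intro l hl
    simp only [Finset.mem_compl, Finset.mem_insert, Finset.mem_singleton, not_or] at hl
    simp [Function.update_of_ne hl.1, Function.update_of_ne hl.2]
  rw [Finset.sum_congr rfl this]
  simp [hij, h]

/-- A finite family with `∑ ‖R (y i)‖² = card` has the same frame operator as a family of vectors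
with `‖R (x i)‖ = 1`. -/
theorem exists_norm_eq_one_of_sum_eq_card {κ : Type*} [Fintype κ] (R : H →L[𝕜] H) (y : κ → H)
    (hy : ∑ i, ‖R (y i)‖ ^ 2 = Fintype.card κ) :
    ∃ x : κ → H, (∀ i, ‖R (x i)‖ = 1) ∧
      ∀ v, ∑ i, ‖inner 𝕜 (x i) v‖ ^ 2 = ∑ i, ‖inner 𝕜 (y i) v‖ ^ 2 := by
  classical
  -- Since the average is 1, an entry off the value 1 forces one entry below and one above. Rotating
  -- this pair puts entry `i` at 1, whatever happens to `j`, so the number of bad entries drops.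
  induction hn : (Finset.univ.filter fun i => ‖R (y i)‖ ^ 2 ≠ 1).card
    using Nat.strong_induction_on generalizing y with
  | _ n ih =>
  by_cases hall : ∀ i, ‖R (y i)‖ ^ 2 = 1
  · exact ⟨y, fun i => (pow_eq_one_iff_of_nonneg (norm_nonneg _) two_ne_zero).1 (hall i), fun _ => rfl⟩
  push Not at hall
  obtain ⟨p, hp⟩ := hall
  have hsum : ∑ i, ‖R (y i)‖ ^ 2 = ∑ _i : κ, (1 : ℝ) := by simp [hy]
  have hlt : ∃ i, ‖R (y i)‖ ^ 2 < 1 := by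
    by_contra! h
    exact hp ((Finset.sum_eq_sum_iff_of_le fun i _ => h i).1 hsum.symm p (Finset.mem_univ p)).symm
  have hgt : ∃ j, 1 < ‖R (y j)‖ ^ 2 := by
    by_contra! h
    exact hp ((Finset.sum_eq_sum_iff_of_le fun i _ => h i).1 hsum p (Finset.mem_univ p))
  obtain ⟨i, hi⟩ := hlt
  obtain ⟨j, hj⟩ := hgt
  have hij : i ≠ j := by rintro rfl; linarith
  obtain ⟨c, s, hcs, h1⟩ := exists_rotation_norm_eq_one R hi.le hj.le
  set z := Function.update (Function.update y i ((c : 𝕜) • y i + (s : 𝕜) • y j)) j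
    ((-s : 𝕜) • y i + (c : 𝕜) • y j) with hz
  have hzi : ‖R (z i)‖ ^ 2 = 1 := by simp [hz, hij, Function.update_of_ne, -map_add, h1]
  have hzl : ∀ l, l ≠ i → l ≠ j → z l = y l := fun l h h' => by simp [hz, h, h']
  have hzsum : ∑ l, ‖R (z l)‖ ^ 2 = Fintype.card κ := by
    rw [← hy]
    refine sum_update_update hij (fun w => ‖R w‖ ^ 2) ?_
    simpa using norm_sq_rotation (𝕜 := 𝕜) (a := R (y i)) (b := R (y j)) hcs
  have hcard : (Finset.univ.filter fun l => ‖R (z l)‖ ^ 2 ≠ 1).card < n := by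
    rw [← hn]
    refine Finset.card_lt_card ⟨fun l hl => ?_, fun h => ?_⟩
    · simp only [Finset.mem_filter, Finset.mem_univ, true_and] at hl ⊢
      rcases eq_or_ne l i with rfl | hli
      · exact hi.ne
      rcases eq_or_ne l j with rfl | hlj
      · exact hj.ne'
      · rwa [hzl l hli hlj] at hl
    · have := h (Finset.mem_filter.2 ⟨Finset.mem_univ i, hi.ne⟩)
      simp only [Finset.mem_filter] at this
      exact this.2 hzi
  obtain ⟨x, hx, hxv⟩ := ih _ hcard z hzsum rfl
  refine ⟨x, hx, fun v => (hxv v).trans ?_⟩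
  exact sum_update_update hij (fun w => ‖inner 𝕜 w v‖ ^ 2) (norm_inner_sq_rotation hcs v)

/-- A finite family `y` with `∑ ‖R (y i)‖² = k` for an integer `k` not below its length has the
same frame operator as a family of `k` vectors with `‖R (x i)‖ = 1`. -/
theorem exists_fin_norm_eq_one {κ : Type*} [Fintype κ] (R : H →L[𝕜] H) (y : κ → H) {k : ℕ}
    (hk : Fintype.card κ ≤ k) (hy : ∑ i, ‖R (y i)‖ ^ 2 = k) :
    ∃ x : Fin k → H, (∀ i, ‖R (x i)‖ = 1) ∧
      ∀ v, ∑ i, ‖inner 𝕜 (x i) v‖ ^ 2 = ∑ i, ‖inner 𝕜 (y i) v‖ ^ 2 := by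
  -- Padding with zero vectors changes neither the total nor the frame operator.
  let y' : κ ⊕ Fin (k - Fintype.card κ) → H := Sum.elim y 0
  have hcard : Fintype.card (κ ⊕ Fin (k - Fintype.card κ)) = k := by simp; omega
  obtain ⟨x, hx, hxv⟩ := exists_norm_eq_one_of_sum_eq_card R y' (by simp [hcard, y', hy])
  let e := (Fintype.equivFinOfCardEq hcard).symm
  refine ⟨x ∘ e, fun i => hx _, fun v => ?_⟩
  refine (Equiv.sum_comp e fun i => ‖inner 𝕜 (x i) v‖ ^ 2).trans ?_
  rw [hxv]
  simp [y']

/-! ### The surface and the operator `(T T*)⁻¹` -/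

theorem mem_ellipsoid_iff {T : (H →L[𝕜] H)ˣ} {x : H} :
    x ∈ ellipsoid T ↔ ‖((T⁻¹ : (H →L[𝕜] H)ˣ) : H →L[𝕜] H) x‖ = 1 := by
  have h1 : ∀ y, ((T⁻¹ : (H →L[𝕜] H)ˣ) : H →L[𝕜] H) ((T : H →L[𝕜] H) y) = y := fun y => by
    rw [← mul_apply_eq_comp, T.inv_mul, one_apply_eq_self]
  have h2 : ∀ y, (T : H →L[𝕜] H) (((T⁻¹ : (H →L[𝕜] H)ˣ) : H →L[𝕜] H) y) = y := fun y => by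
    rw [← mul_apply_eq_comp, T.mul_inv, one_apply_eq_self]
  constructor
  · rintro ⟨y, hy, rfl⟩
    simpa [h1] using hy
  · exact fun h => ⟨_, by simpa using h, h2 x⟩

/-- The Parseval-type identity alone makes a family a tight frame. -/
theorem isTightFrame_of_hasSum [CompleteSpace H] {ι : Type*} {K : ℝ} (hK : 0 < K) {x : ι → H}
    (h : ∀ v, HasSum (fun i => ‖inner 𝕜 (x i) v‖ ^ 2) (K * ‖v‖ ^ 2)) : IsTightFrame 𝕜 K x where
  pos := hK
  le := le_rfl
  complete := by
    rw [Submodule.dense_iff_topologicalClosure_eq_top, Submodule.topologicalClosure_eq_top_iff,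
      Submodule.eq_bot_iff]
    intro v hv
    have h0 : ∀ i, ‖inner 𝕜 (x i) v‖ ^ 2 = 0 := fun i => by
      rw [hv _ (Submodule.subset_span ⟨i, rfl⟩)]; simp
    have := (h v).unique (by simp only [h0]; exact hasSum_zero)
    simpa [hK.ne'] using this
  summable v := (h v).summable
  lower v := (h v).tsum_eq.ge
  upper v := (h v).tsum_eq.le

theorem IsETF.norm_inv_apply {ι : Type*} {T : (H →L[𝕜] H)ˣ} {K : ℝ} {x : ι → H} (h : IsETF T K x)
    (i : ι) : ‖((T⁻¹ : (H →L[𝕜] H)ˣ) : H →L[𝕜] H) (x i)‖ = 1 :=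
  mem_ellipsoid_iff.1 (h.1 i)

/-- This identifies the quadratic form of `invSq T` with `‖T⁻¹ ·‖²`, the quantity that the rotations
control. -/
theorem invSq_eq [CompleteSpace H] (T : (H →L[𝕜] H)ˣ) :
    invSq T = star ((T⁻¹ : (H →L[𝕜] H)ˣ) : H →L[𝕜] H) * ((T⁻¹ : (H →L[𝕜] H)ˣ) : H →L[𝕜] H) := by
  rw [invSq, mul_inv_rev, Units.val_mul, ← Units.coe_star, star_inv]

/-- The surface of a unit determines `(T T*)⁻¹`. -/
theorem invSq_eq_of_ellipsoid_eq [CompleteSpace H] {S T : (H →L[𝕜] H)ˣ}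
    (h : ellipsoid S = ellipsoid T) : invSq S = invSq T := by
  -- Equal surfaces make `T⁻¹ S` an invertible isometry, hence unitary.
  have hnorm : ∀ x, ‖(T⁻¹ * S : (H →L[𝕜] H)ˣ).val x‖ = ‖x‖ := by
    intro x
    rcases eq_or_ne x 0 with rfl | hx
    · simp
    have hx' : ‖x‖ ≠ 0 := norm_ne_zero_iff.2 hx
    have hmem : (S : H →L[𝕜] H) (((‖x‖⁻¹ : ℝ) : 𝕜) • x) ∈ ellipsoid T := by
      rw [← h]
      exact ⟨_, by simp [norm_smul, hx'], rfl⟩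
    rw [mem_ellipsoid_iff, ← mul_apply_eq_comp, map_smul, norm_smul,
      RCLike.norm_ofReal, abs_of_nonneg (by positivity)] at hmem
    field_simp at hmem
    simpa using hmem
  have h1 := (ContinuousLinearMap.norm_map_iff_adjoint_comp_self _).1 hnorm
  have hu : star (T⁻¹ * S) * (T⁻¹ * S) = 1 := Units.ext h1
  unfold invSq
  congr 2
  have : S * star S = T * star T := by
    have h2 : (T⁻¹ * S) * star (T⁻¹ * S) = 1 := mul_eq_one_comm.1 hu
    rw [star_mul, star_inv] at h2
    calc S * star S = T * (T⁻¹ * S * (star S * (star T)⁻¹)) * star T := by group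
      _ = T * star T := by rw [h2, mul_one]
  exact this

theorem invSq_eq_inv_sq_of_isPositive [CompleteSpace H] {S : (H →L[𝕜] H)ˣ}
    (h : (S : H →L[𝕜] H).IsPositive) :
    invSq S = ((S⁻¹ : (H →L[𝕜] H)ˣ) : H →L[𝕜] H) ^ 2 := by
  have hS : star S = S := Units.ext h.isSelfAdjoint
  rw [invSq, hS, mul_inv_rev, Units.val_mul, sq]

/-! ### Finite dimension: trace and frame bound -/

section FiniteDimensional

theorem sum_norm_sq_inv_pos {ι : Type*} [Fintype ι] [Nontrivial H] (T : (H →L[𝕜] H)ˣ) (b : OrthonormalBasis ι 𝕜 H) :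
    0 < ∑ i, ‖((T⁻¹ : (H →L[𝕜] H)ˣ) : H →L[𝕜] H) (b i)‖ ^ 2 := by
  have : Nonempty ι := b.toBasis.index_nonempty
  refine Finset.sum_pos (fun i _ => ?_) Finset.univ_nonempty
  have : ((T⁻¹ : (H →L[𝕜] H)ˣ) : H →L[𝕜] H) (b i) ≠ 0 := fun h => by
    have h' : (T : H →L[𝕜] H) (((T⁻¹ : (H →L[𝕜] H)ˣ) : H →L[𝕜] H) (b i)) = b i := by
      rw [← mul_apply_eq_comp, T.mul_inv, one_apply_eq_self]
    rw [h, map_zero] at h'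
    exact b.orthonormal.ne_zero i h'.symm
  positivity

variable [CompleteSpace H] {ι : Type*} [Fintype ι]

theorem trace_invSq (T : (H →L[𝕜] H)ˣ) (b : OrthonormalBasis ι 𝕜 H) :
    LinearMap.trace 𝕜 H (invSq T : H →ₗ[𝕜] H) =
      ((∑ i, ‖((T⁻¹ : (H →L[𝕜] H)ˣ) : H →L[𝕜] H) (b i)‖ ^ 2 : ℝ) : 𝕜) := by
  rw [LinearMap.trace_eq_sum_inner _ b, RCLike.ofReal_sum]
  refine Finset.sum_congr rfl fun i _ => ?_
  rw [invSq_eq, ContinuousLinearMap.coe_coe, mul_apply_eq_comp,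
    ContinuousLinearMap.star_eq_adjoint, ContinuousLinearMap.adjoint_inner_right,
    inner_self_eq_norm_sq_to_K]
  simp

theorem sum_norm_sq_adjoint (R : H →L[𝕜] H) (b : OrthonormalBasis ι 𝕜 H) :
    ∑ i, ‖ContinuousLinearMap.adjoint R (b i)‖ ^ 2 = ∑ i, ‖R (b i)‖ ^ 2 := by
  simp_rw [← b.sum_sq_norm_inner_right (ContinuousLinearMap.adjoint R _),
    ← b.sum_sq_norm_inner_left (R _), ContinuousLinearMap.adjoint_inner_right]
  exact Finset.sum_comm

/-- The double sum of `|⟨x j, R* (b i)⟩|²` is evaluated twice: over `j` by tightness, over `i` by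
Parseval. -/
theorem IsETF.mul_sum_norm_sq {k : ℕ} {T : (H →L[𝕜] H)ˣ} {K : ℝ} {x : Fin k → H}
    (h : IsETF T K x) (b : OrthonormalBasis ι 𝕜 H) :
    K * ∑ i, ‖((T⁻¹ : (H →L[𝕜] H)ˣ) : H →L[𝕜] H) (b i)‖ ^ 2 = k := by
  set R := ((T⁻¹ : (H →L[𝕜] H)ˣ) : H →L[𝕜] H) with hR
  have htight : ∀ v, ∑ j, ‖inner 𝕜 (x j) v‖ ^ 2 = K * ‖v‖ ^ 2 := fun v => by
    rw [← tsum_fintype (L := .unconditional _)]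
    exact le_antisymm (h.2.upper v) (h.2.lower v)
  calc K * ∑ i, ‖R (b i)‖ ^ 2
      = ∑ i, ∑ j, ‖inner 𝕜 (x j) (ContinuousLinearMap.adjoint R (b i))‖ ^ 2 := by
        simp_rw [htight, ← Finset.mul_sum, sum_norm_sq_adjoint]
    _ = ∑ j, ‖R (x j)‖ ^ 2 := by
        rw [Finset.sum_comm]
        simp_rw [ContinuousLinearMap.adjoint_inner_right, b.sum_sq_norm_inner_left]
    _ = k := by simp [hR, h.norm_inv_apply]

theorem exists_isETF_fin [Nontrivial H] (T : (H →L[𝕜] H)ˣ) (b : OrthonormalBasis ι 𝕜 H) {k : ℕ}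
    (hk : Fintype.card ι ≤ k) : ∃ (K : ℝ) (x : Fin k → H), IsETF T K x := by
  set R := ((T⁻¹ : (H →L[𝕜] H)ˣ) : H →L[𝕜] H) with hR
  have hpos := sum_norm_sq_inv_pos T b
  have : Nonempty ι := b.toBasis.index_nonempty
  have hk0 : (0 : ℝ) < k := by exact_mod_cast Fintype.card_pos.trans_le hk
  set K : ℝ := k / ∑ i, ‖R (b i)‖ ^ 2 with hK
  have hK0 : 0 < K := div_pos hk0 hpos
  obtain ⟨x, hx, hxv⟩ := exists_fin_norm_eq_one R (fun i => ((√K : ℝ) : 𝕜) • b i) hk (by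
    simp only [map_smul, norm_smul, mul_pow, RCLike.norm_ofReal, sq_abs, Real.sq_sqrt hK0.le]
    rw [← Finset.mul_sum, hK, div_mul_cancel₀ _ hpos.ne'])
  refine ⟨K, x, fun i => mem_ellipsoid_iff.2 (hx i), isTightFrame_of_hasSum hK0 fun v => ?_⟩
  convert! hasSum_fintype _
  rw [hxv]
  simp only [inner_smul_left, norm_mul, mul_pow, RCLike.norm_conj, RCLike.norm_ofReal, sq_abs,
    Real.sq_sqrt hK0.le]
  rw [← Finset.mul_sum, b.sum_sq_norm_inner_right]

end FiniteDimensional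

/-! ### Infinite dimension: Parseval frames from blocks -/

theorem HilbertBasis.hasSum_norm_inner_sq {ι : Type*} (b : HilbertBasis ι 𝕜 H) (v : H) :
    HasSum (fun i => ‖inner 𝕜 (b i) v‖ ^ 2) (‖v‖ ^ 2) := by
  have h := (b.hasSum_inner_mul_inner v v).mapL RCLike.reCLM
  simp only [RCLike.reCLM_apply, inner_self_eq_norm_sq] at h
  refine h.congr_fun fun i => ?_
  rw [← inner_conj_symm v, RCLike.conj_mul, ← RCLike.ofReal_pow, RCLike.ofReal_re]

/-- In a separable space an orthonormal family is countable. -/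
theorem Orthonormal.countable_index [TopologicalSpace.SeparableSpace H] {ι : Type*} {b : ι → H}
    (hb : Orthonormal 𝕜 b) : Countable ι := by
  refine Pairwise.countable_of_isOpen_disjoint (s := fun i => Metric.ball (b i) (1 / 2))
    (fun i j hij => Metric.ball_disjoint_ball ?_) (fun _ => Metric.isOpen_ball)
    (fun i => ⟨b i, Metric.mem_ball_self (by norm_num)⟩)
  have h : ‖b i - b j‖ ^ 2 = 2 := by
    rw [norm_sub_sq (𝕜 := 𝕜), hb.1, hb.1, hb.2 hij]
    norm_num
  rw [dist_eq_norm]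
  nlinarith [norm_nonneg (b i - b j)]

/-- An orthonormal sequence in a separable Hilbert space can be completed by a sequence of vectors
to a Parseval frame. -/
theorem Orthonormal.exists_hasSum_add [CompleteSpace H] [TopologicalSpace.SeparableSpace H]
    {f : ℕ → H} (hf : Orthonormal 𝕜 f) :
    ∃ e : ℕ → H, ∀ v, ∃ a b : ℝ, HasSum (fun n => ‖inner 𝕜 (f n) v‖ ^ 2) a ∧
      HasSum (fun n => ‖inner 𝕜 (e n) v‖ ^ 2) b ∧ a + b = ‖v‖ ^ 2 := by
  classical
  obtain ⟨w, b, hw, hb⟩ := hf.toSubtypeRange.exists_hilbertBasis_extension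
  have : Countable w := (hb ▸ b.orthonormal).countable_index
  let s : Set w := Set.range fun n => ⟨f n, hw ⟨n, rfl⟩⟩
  have hinj : Function.Injective fun n => (⟨f n, hw ⟨n, rfl⟩⟩ : w) := fun m n h =>
    hf.linearIndependent.injective (congrArg Subtype.val h)
  obtain ⟨enc, henc⟩ := exists_injective_nat (sᶜ : Set w)
  -- The complement may be finite or empty; the value 0 off the range of `enc` pads it to a
  -- sequence.
  refine ⟨Function.extend enc (fun i => (i : H)) 0, fun v => ?_⟩
  have hsum := b.hasSum_norm_inner_sq v
  rw [hb] at hsum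
  refine ⟨_, _, ?_, ?_, hsum.summable.tsum_subtype_add_tsum_subtype_compl s |>.trans hsum.tsum_eq⟩
  · have h := (hsum.summable.subtype s).hasSum
    exact (hinj.hasSum_range_iff (f := fun i : w => ‖inner 𝕜 (i : H) v‖ ^ 2)).1 h
  · have h := (hasSum_extend_zero henc).2 (hsum.summable.subtype sᶜ).hasSum
    refine h.congr_fun fun n => ?_
    by_cases hn : ∃ i, enc i = n
    · obtain ⟨i, rfl⟩ := hn
      simp [henc.extend_apply]
    · simp [Function.extend_apply' _ _ _ hn]

/-- Weights `t n ∈ [0, 1]` that split the `n`-th entry of a sequence `q ≥ 1` between the blocks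
`n - 1` and `n`, so that all block sums become integers. -/
theorem exists_split_weights {q S : ℕ → ℝ} (m : ℕ) (hq : ∀ n, 1 ≤ q n) (hS : ∀ n, (m : ℝ) ≤ S n) :
    ∃ (t : ℕ → ℝ) (k : ℕ → ℕ), t 0 = 0 ∧ (∀ n, t n ∈ Set.Icc (0 : ℝ) 1) ∧
      ∀ n, m + 1 ≤ k n ∧ (1 - t n) * q n + S n + t (n + 1) * q (n + 1) = k n := by
  have hstep : ∀ n (c : Set.Icc (0 : ℝ) 1), ∃ (c' : Set.Icc (0 : ℝ) 1) (k : ℕ),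
      m + 1 ≤ k ∧ (1 - (c : ℝ)) * q n + S n + c' * q (n + 1) = k := by
    rintro n ⟨c, hc0, hc1⟩
    set r := (1 - c) * q n + S n with hr
    have hmr : (m : ℝ) ≤ r := by
      have : 0 ≤ (1 - c) * q n := mul_nonneg (by linarith) (by linarith [hq n])
      linarith [hS n]
    have hr0 : 0 ≤ r := (Nat.cast_nonneg m).trans hmr
    have hq0 : 0 < q (n + 1) := by linarith [hq (n + 1)]
    have h1 := Nat.lt_floor_add_one r
    have h2 := Nat.floor_le hr0
    -- The missing amount `⌊r⌋₊ + 1 - r` is at most `1 ≤ q (n + 1)`, so a fraction of the next entry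
    -- covers it.
    refine ⟨⟨(⌊r⌋₊ + 1 - r) / q (n + 1), div_nonneg (by linarith) hq0.le, ?_⟩, ⌊r⌋₊ + 1, ?_, ?_⟩
    · rw [div_le_one hq0]
      linarith [hq (n + 1)]
    · exact Nat.succ_le_succ (Nat.le_floor hmr)
    · push_cast
      rw [div_mul_cancel₀ _ hq0.ne']
      ring
  choose next k hk hnext using hstep
  let t : ℕ → Set.Icc (0 : ℝ) 1 := fun n => Nat.rec ⟨0, by simp⟩ next n
  exact ⟨fun n => (t n).1, fun n => k n (t n), rfl, fun n => (t n).2,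
    fun n => ⟨hk n (t n), hnext n (t n)⟩⟩

/-- If `‖R f‖² ≥ δ > 1` along an orthonormal sequence, there is a countable Parseval frame of
vectors with `‖R x‖ = 1`. -/
theorem exists_parseval_norm_eq_one [CompleteSpace H] [TopologicalSpace.SeparableSpace H]
    (R : H →L[𝕜] H) {f : ℕ → H} (hf : Orthonormal 𝕜 f) {δ : ℝ} (hδ : 1 < δ)
    (hfR : ∀ n, δ ≤ ‖R (f n)‖ ^ 2) :
    ∃ (ι : Type) (_ : Countable ι) (x : ι → H), (∀ i, ‖R (x i)‖ = 1) ∧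
      ∀ v, HasSum (fun i => ‖inner 𝕜 (x i) v‖ ^ 2) (‖v‖ ^ 2) := by
  obtain ⟨e, he⟩ := hf.exists_hasSum_add
  -- A block has `l + 3` entries: two split vectors, one `e n` and `l` vectors `h n i`. With `l (δ -
  -- 1) ≥ 2` the last alone contribute `l δ ≥ l + 2`, and the next integer up is at least `l + 3`.
  obtain ⟨l, hl⟩ := exists_nat_ge (2 / (δ - 1))
  rw [div_le_iff₀ (by linarith)] at hl
  obtain ⟨σ⟩ := nonempty_equiv_of_countable (α := ℕ × Option (Fin l)) (β := ℕ)
  let g : ℕ → H := fun n => f (σ (n, none))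
  let h : ℕ → Fin l → H := fun n i => f (σ (n, some i))
  obtain ⟨t, k, ht0, ht, hk⟩ := exists_split_weights (q := fun n => ‖R (g n)‖ ^ 2)
    (S := fun n => ‖R (e n)‖ ^ 2 + ∑ i, ‖R (h n i)‖ ^ 2) (l + 2)
    (fun n => hδ.le.trans (hfR _)) fun n => by
      have h1 : ∑ _i : Fin l, δ ≤ ∑ i, ‖R (h n i)‖ ^ 2 := Finset.sum_le_sum fun i _ => hfR _
      simp only [Finset.sum_const, Finset.card_univ, Fintype.card_fin, nsmul_eq_mul] at h1
      push_cast
      nlinarith [sq_nonneg ‖R (e n)‖]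
  let y : ∀ _ : ℕ, Option (Option (Option (Fin l))) → H := fun n i =>
    i.elim (((√(1 - t n) : ℝ) : 𝕜) • g n) fun i =>
      i.elim (((√(t (n + 1)) : ℝ) : 𝕜) • g (n + 1)) fun i => i.elim (e n) (h n)
  have ht1 : ∀ n, 0 ≤ 1 - t n := fun n => sub_nonneg.2 (ht n).2
  have hblock : ∀ n, ∃ x : Fin (k n) → H, (∀ i, ‖R (x i)‖ = 1) ∧
      ∀ v, ∑ i, ‖inner 𝕜 (x i) v‖ ^ 2 = ∑ i, ‖inner 𝕜 (y n i) v‖ ^ 2 := fun n =>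
    exists_fin_norm_eq_one R (y n) (by simpa using (hk n).1) (by
      rw [← (hk n).2]
      simp only [y, Fintype.sum_option, Option.elim_none, Option.elim_some, map_smul, norm_smul,
        mul_pow, RCLike.norm_ofReal, sq_abs, Real.sq_sqrt (ht1 n), Real.sq_sqrt (ht _).1]
      ring)
  choose x hx hxv using hblock
  refine ⟨Σ n, Fin (k n), inferInstance, fun i => x i.1 i.2, fun i => hx _ _, fun v => ?_⟩
  obtain ⟨a, b, ha, hb, hab⟩ := he v
  have hfib : HasSum (fun n => ‖inner 𝕜 (g n) v‖ ^ 2 + ∑ i, ‖inner 𝕜 (h n i) v‖ ^ 2) a := by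
    refine HasSum.prod_fiberwise (σ.hasSum_iff.2 ha) fun n => ?_
    have := hasSum_fintype fun i => ‖inner 𝕜 (f (σ (n, i))) v‖ ^ 2
    rwa [Fintype.sum_option] at this
  have hsg : Summable fun n => ‖inner 𝕜 (g n) v‖ ^ 2 :=
    hfib.summable.of_nonneg_of_le (fun n => by positivity) fun n =>
      le_add_of_nonneg_right (by positivity)
  have hst : Summable fun n => t n * ‖inner 𝕜 (g n) v‖ ^ 2 :=
    hsg.of_nonneg_of_le (fun n => mul_nonneg (ht n).1 (by positivity)) fun n =>
      mul_le_of_le_one_left (by positivity) (ht n).2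
  -- The parts handed to the preceding block are recovered in full, because `t 0 = 0`.
  have hshift : HasSum (fun n => t (n + 1) * ‖inner 𝕜 (g (n + 1)) v‖ ^ 2)
      (∑' n, t n * ‖inner 𝕜 (g n) v‖ ^ 2) := by
    simpa [ht0] using (hasSum_nat_add_iff' 1).2 hst.hasSum
  have hbl : HasSum (fun n => ∑ i, ‖inner 𝕜 (x n i) v‖ ^ 2) (‖v‖ ^ 2) := by
    have := ((hfib.add hb).sub hst.hasSum).add hshift
    rw [sub_add_cancel, hab] at this
    refine this.congr_fun fun n => ?_
    rw [hxv]
    simp only [y, Fintype.sum_option, Option.elim_none, Option.elim_some, inner_smul_left, norm_mul,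
      mul_pow, RCLike.norm_conj, RCLike.norm_ofReal, sq_abs, Real.sq_sqrt (ht1 n),
      Real.sq_sqrt (ht _).1]
    ring
  refine HasSum.sigma_of_hasSum hbl (fun n => hasSum_fintype _) ?_
  refine (summable_sigma_of_nonneg fun i => by positivity).2 ⟨fun n => (hasSum_fintype _).summable, ?_⟩
  simpa only [tsum_fintype] using hbl.summable

/-! ### Essential norm and almost extremal orthonormal sequences -/

theorem bddBelow_essNorm_set (B : H →L[𝕜] H) :
    BddBelow {r : ℝ | ∃ C : H →L[𝕜] H, IsCompactOperator C ∧ r = ‖B - C‖} :=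
  ⟨0, by rintro r ⟨C, -, rfl⟩; positivity⟩

theorem essNorm_le_norm_sub {B C : H →L[𝕜] H} (hC : IsCompactOperator C) :
    essNorm B ≤ ‖B - C‖ :=
  csInf_le (bddBelow_essNorm_set B) ⟨C, hC, rfl⟩

/-- In infinite dimension a unit is not compact, and its distance to the compact operators is
positive. -/
theorem essNorm_pos [CompleteSpace H] (hH : ¬ FiniteDimensional 𝕜 H) (B : (H →L[𝕜] H)ˣ) :
    0 < essNorm (B : H →L[𝕜] H) := by
  have hnt : Nontrivial H := by
    by_contra h
    rw [not_nontrivial_iff_subsingleton] at h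
    exact hH inferInstance
  have hpos : 0 < ‖((B⁻¹ : (H →L[𝕜] H)ˣ) : H →L[𝕜] H)‖⁻¹ := inv_pos.2 (Units.norm_pos _)
  refine hpos.trans_le (le_csInf ⟨_, 0, isCompactOperator_zero, rfl⟩ ?_)
  rintro r ⟨C, hC, rfl⟩
  by_contra! hlt
  rw [norm_sub_rev] at hlt
  -- A compact operator this close to `B` would be invertible, making the identity compact.
  let U := B.ofNearby C hlt
  have hid : IsCompactOperator (((U⁻¹ : (H →L[𝕜] H)ˣ) : H →L[𝕜] H) ∘ C) := hC.clm_comp _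
  have h1 : ⇑((U⁻¹ : (H →L[𝕜] H)ˣ) : H →L[𝕜] H) ∘ C = id := by
    ext z
    exact DFunLike.congr_fun U.inv_mul z
  rw [h1] at hid
  exact hH ((isCompactOperator_id_iff_finiteDimensional (𝕜 := 𝕜)).1 hid)

/-- The form `‖R ·‖²` comes close to the essential norm of `R* R` on unit vectors orthogonal to a
given finite set. -/
theorem exists_unit_orthogonal_of_lt_essNorm [CompleteSpace H] (R : H →L[𝕜] H) {c : ℝ} (hc0 : 0 ≤ c)
    (hc : c < essNorm (star R * R)) (s : Finset H) :
    ∃ y, ‖y‖ = 1 ∧ c ≤ ‖R y‖ ^ 2 ∧ ∀ x ∈ s, inner 𝕜 x y = 0 := by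
  by_contra! hcon
  let F := Submodule.span 𝕜 (s : Set H)
  have : FiniteDimensional 𝕜 F := FiniteDimensional.span_finset 𝕜 s
  let Q : H →L[𝕜] H := F.starProjection
  let P : H →L[𝕜] H := 1 - Q
  have hPorth : ∀ v, ∀ x ∈ s, inner 𝕜 x (P v) = 0 := fun v x hx =>
    F.sub_starProjection_mem_orthogonal v x (Submodule.subset_span hx)
  have hPnorm : ∀ v, ‖P v‖ ≤ ‖v‖ := fun v => by
    have h1 : P v = Fᗮ.starProjection v := by
      simp [P, Q, Submodule.starProjection_orthogonal]
    rw [h1]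
    exact Fᗮ.norm_starProjection_apply_le v
  have hRP : ‖R * P‖ ≤ √c := by
    refine ContinuousLinearMap.opNorm_le_bound _ (Real.sqrt_nonneg _) fun v => ?_
    rw [mul_apply_eq_comp]
    refine le_trans ?_ (mul_le_mul_of_nonneg_left (hPnorm v) (Real.sqrt_nonneg c))
    rcases eq_or_ne (P v) 0 with h0 | h0
    · simp [h0]
    have hn : ‖P v‖ ≠ 0 := norm_ne_zero_iff.2 h0
    set u := ((‖P v‖⁻¹ : ℝ) : 𝕜) • P v with hu
    by_contra! hlt
    obtain ⟨x, hx, hne⟩ := hcon u (by simp [hu, norm_smul, hn]) (by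
      rw [hu, map_smul, norm_smul, RCLike.norm_ofReal, abs_of_nonneg (by positivity), mul_pow,
        inv_pow, ← div_eq_inv_mul, le_div_iff₀ (by positivity)]
      calc c * ‖P v‖ ^ 2 = (√c * ‖P v‖) ^ 2 := by rw [mul_pow, Real.sq_sqrt hc0]
        _ ≤ ‖R (P v)‖ ^ 2 := by gcongr)
    exact hne (by rw [hu, inner_smul_right, hPorth v x hx, mul_zero])
  have hQ : IsCompactOperator Q := by
    have h1 : IsCompactOperator (id : F → F) :=
      (isCompactOperator_id_iff_finiteDimensional (𝕜 := 𝕜)).2 inferInstance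
    exact (h1.comp_clm F.orthogonalProjectionOnto).clm_comp F.subtypeL
  have hPself : star P = P := by
    simp only [P, star_sub, star_one]
    rw [show star Q = Q from (isSelfAdjoint_starProjection F)]
  -- Compressing `R* R` to the complement of `F` changes it only by terms containing the finite-rank
  -- `Q`, so the essential norm is at most `‖R P‖² ≤ c`.
  have hdecomp : star R * R - (star R * R * Q + Q * (star R * R * P)) = star (R * P) * (R * P) := by
    rw [star_mul, hPself]
    simp only [P]
    noncomm_ring
  have hcomp : IsCompactOperator (star R * R * Q + Q * (star R * R * P) : H →L[𝕜] H) :=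
    (hQ.clm_comp (star R * R)).add (hQ.comp_clm (star R * R * P))
  have hle := essNorm_le_norm_sub (B := star R * R) hcomp
  rw [hdecomp] at hle
  replace hle := hle.trans_eq (ContinuousLinearMap.norm_adjoint_comp_self (R * P))
  have : ‖R * P‖ * ‖R * P‖ ≤ √c * √c := by gcongr
  rw [Real.mul_self_sqrt hc0] at this
  linarith

theorem exists_orthonormal_seq_of_lt_essNorm [CompleteSpace H] (R : H →L[𝕜] H) {c : ℝ} (hc0 : 0 ≤ c)
    (hc : c < essNorm (star R * R)) : ∃ f : ℕ → H, Orthonormal 𝕜 f ∧ ∀ n, c ≤ ‖R (f n)‖ ^ 2 := by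
  have : Std.Symm fun x y : H => inner 𝕜 x y = 0 := ⟨fun _ _ => inner_eq_zero_symm.1⟩
  obtain ⟨f, hf, hf'⟩ := exists_seq_of_forall_finset_exists'
    (fun y : H => ‖y‖ = 1 ∧ c ≤ ‖R y‖ ^ 2) (fun x y => inner 𝕜 x y = 0) fun s _ => by
      obtain ⟨y, h1, h2, h3⟩ := exists_unit_orthogonal_of_lt_essNorm R hc0 hc s
      exact ⟨y, ⟨h1, h2⟩, h3⟩
  exact ⟨f, ⟨fun n => (hf n).1, hf'⟩, fun n => (hf n).2⟩

theorem isAttainable_of_inv_essNorm_lt [CompleteSpace H] [TopologicalSpace.SeparableSpace H]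
    (hH : ¬ FiniteDimensional 𝕜 H) (T : (H →L[𝕜] H)ˣ) {K : ℝ} (hK : (essNorm (invSq T))⁻¹ < K) :
    IsAttainable T K := by
  have hess : 0 < essNorm (invSq T) := essNorm_pos hH _
  have hK0 : 0 < K := (inv_pos.2 hess).trans hK
  -- Taking `c` strictly above `K⁻¹` gives `δ = K * c > 1` for the rescaled operator `√K • R`.
  obtain ⟨c, hc1, hc2⟩ := exists_between (inv_lt_of_inv_lt₀ hess hK)
  have hc0 : 0 < c := (inv_pos.2 hK0).trans hc1
  rw [invSq_eq] at hc2
  set R := ((T⁻¹ : (H →L[𝕜] H)ˣ) : H →L[𝕜] H) with hR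
  obtain ⟨f, hf, hfR⟩ := exists_orthonormal_seq_of_lt_essNorm R hc0.le hc2
  have hsq : √K ^ 2 = K := Real.sq_sqrt hK0.le
  obtain ⟨ι, hι, x, hx, hxv⟩ := exists_parseval_norm_eq_one (((√K : ℝ) : 𝕜) • R) hf
    (δ := K * c) (by rwa [inv_lt_iff_one_lt_mul₀' hK0] at hc1) fun n => by
      rw [smul_apply, norm_smul, mul_pow, RCLike.norm_ofReal, sq_abs, hsq]
      exact mul_le_mul_of_nonneg_left (hfR n) hK0.le
  refine ⟨ι, hι, fun i => ((√K : ℝ) : 𝕜) • x i, fun i => mem_ellipsoid_iff.2 ?_,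
    isTightFrame_of_hasSum hK0 fun v => ?_⟩
  · rw [map_smul]
    exact hx i
  · simpa only [inner_smul_left, norm_mul, mul_pow, RCLike.norm_conj, RCLike.norm_ofReal, sq_abs,
      hsq] using (hxv v).mul_left K

end EllipsoidalFramesAux

theorem theorem3 {𝕜 : Type*} [RCLike 𝕜] {H : Type*} [NormedAddCommGroup H]
    [InnerProductSpace 𝕜 H] [CompleteSpace H] [TopologicalSpace.SeparableSpace H] [Nontrivial H]
    (T : (H →L[𝕜] H)ˣ) :
    -- the surface contains a tight frame
    (∃ K : ℝ, IsAttainable T K) ∧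
    -- `invSq T` is `S⁻²` for any positive `S` with the same surface, in particular for `S = T`
    -- when `T` is positive
    (∀ S : (H →L[𝕜] H)ˣ, (S : H →L[𝕜] H).IsPositive → ellipsoid S = ellipsoid T →
      invSq T = ((S⁻¹ : (H →L[𝕜] H)ˣ) : H →L[𝕜] H) ^ 2) ∧
    -- finite dimension
    (FiniteDimensional 𝕜 H → ∀ k : ℕ, Module.finrank 𝕜 H ≤ k →
      (∃ (K : ℝ) (x : Fin k → H), IsETF T K x) ∧
      ∀ (K : ℝ) (x : Fin k → H), IsETF T K x →
        (K : 𝕜) = (k : 𝕜) * (LinearMap.trace 𝕜 H (invSq T : H →ₗ[𝕜] H))⁻¹) ∧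
    -- infinite dimension
    (¬ FiniteDimensional 𝕜 H → ∀ K : ℝ, (essNorm (invSq T))⁻¹ < K → IsAttainable T K) := by
  refine ⟨?_, fun S hS h => ?_, fun hfin k hk => ⟨?_, fun K x hx => ?_⟩,
    fun hH K hK => isAttainable_of_inv_essNorm_lt hH T hK⟩
  · by_cases hfin : FiniteDimensional 𝕜 H
    · obtain ⟨K, x, hx⟩ := exists_isETF_fin T (stdOrthonormalBasis 𝕜 H) le_rfl
      exact ⟨K, _, inferInstance, x, hx⟩
    · exact ⟨_, isAttainable_of_inv_essNorm_lt hfin T (lt_add_one _)⟩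
  · rw [← invSq_eq_of_ellipsoid_eq h, invSq_eq_inv_sq_of_isPositive hS]
  · exact exists_isETF_fin T (stdOrthonormalBasis 𝕜 H) (by simpa using hk)
  · have hpos := sum_norm_sq_inv_pos T (stdOrthonormalBasis 𝕜 H)
    have hmul := hx.mul_sum_norm_sq (stdOrthonormalBasis 𝕜 H)
    rw [trace_invSq T (stdOrthonormalBasis 𝕜 H), ← RCLike.ofReal_inv, ← RCLike.ofReal_natCast k,
      ← RCLike.ofReal_mul, ← hmul, mul_inv_cancel_right₀ hpos.ne']
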